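/- **Setting.** Let $X,U,Y$ be finite-dimensional real Hilbert spaces, $\Theta$ a set and $\theta\in\Theta$ fixed. Let $K:X\to U$ be linear with adjoint $K^*$, let $\tau,\xi>0$ and $\zeta\in\mathbb R$, and let $H:X\times Y\times\Theta\to(-\infty,+\infty]$, $G:U\times Y\times\Theta\to(-\infty,+\infty]$ be such that $x\mapsto H(x,y,\theta)$ and $u\mapsto G(u,y,\theta)$ are proper, closed and convex for every $y\in Y$. Write $\mathrm{Prox}_h(x)=\operatorname{argmin}_z\ \tfrac12\|z-x\|^2+h(z)$ and $G^*(u,y,\theta)=\sup_z\ \langle z,u\rangle-G(z,y,\theta)$, and let $\mathrm{Prox}_{\xi H}(x,y,\theta)$ and $\mathrm{Prox}_{\tau G^*}(u,y,\theta)$ be the proximity operators of $\xi H(\cdot,y,\theta)$ and $\tau G^*(\cdot,y,\theta)$ at $x$ and $u$. The Chambolle–Pock primal–dual algorithm for minimizing $x\mapsto H(x,y,\theta)+G(Kx,y,\theta)$ produces, from an initial state $a^{(0)}(y,\theta)$, the states $a^{(\ell)}=(x^{(\ell)},\tilde x^{(\ell)},u^{(\ell)})$ (functions of $(y,\theta)$),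 $a^{(\ell+1)}=\psi(a^{(\ell)},y,\theta)$, by $$u^{(\ell+1)}=\mathrm{Prox}_{\tau G^*}(U^{(\ell)},y,\theta),\quad U^{(\ell)}=u^{(\ell)}+\tau K\tilde x^{(\ell)},$$ $$x^{(\ell+1)}=\mathrm{Prox}_{\xi H}(X^{(\ell)},y,\theta),\quad X^{(\ell)}=x^{(\ell)}-\xi K^*u^{(\ell+1)},$$ $$\tilde x^{(\ell+1)}=x^{(\ell+1)}+\zeta\,(x^{(\ell+1)}-x^{(\ell)}),$$ and $x^{(\ell)}=\gamma(a^{(\ell)})$ where $\gamma(x,\tilde x,u)=x$. Assume that $y\mapsto a^{(0)}(y,\theta)$ is Lipschitz and that $y\mapsto\psi(a,y,\theta)$ is Lipschitz with a constant that does not depend on $a$. For a map $f$ of two or more arguments, a *version of the Jacobian of $f$ in one of its arguments* is a field of linear maps $J$, indexed by all the arguments, such that, for all values of the other arguments, $J$ is a weak Jacobian of the corresponding partial map (both are locally integrable and integration by parts against $C^1_c$ functions holds), and $J$ equals the classical Jacobian of that partial map wherever that map is classically differentiable. **Claim.** For every $\ell\ge 0$ the maps $y\mapsto a^{(\ell)},u^{(\ell)},x^{(\ell)},\tilde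 x^{(\ell)}$ are weakly differentiable. Moreover there are versions $\mathcal G_u,\mathcal G_y$ of the Jacobians of $\mathrm{Prox}_{\tau G^*}(u,y,\theta)$ in $u$ and in $y$, versions $\mathcal H_x,\mathcal H_y$ of the Jacobians of $\mathrm{Prox}_{\xi H}(x,y,\theta)$ in $x$ and in $y$, and versions $\Psi_a,\Psi_y$ of the Jacobians of $\psi(a,y,\theta)$ in $a$ and in $y$, such that the following holds for any choice of the weak Jacobians of the iterates. For Lebesgue-almost every $y\in Y$, for all $\ell\ge0$ and all $\delta\in Y$, let $\mathcal D_a^{(\ell)},\mathcal D_u^{(\ell)},\mathcal D_x^{(\ell)},\mathcal D_{\tilde x}^{(\ell)}$ be the weak directional derivatives of $a^{(\ell)},u^{(\ell)},x^{(\ell)},\tilde x^{(\ell)}$ with respect to $y$ at $y$ in the direction $\delta$, let $\mathcal G_u^{(\ell)},\mathcal G_y^{(\ell)}$ be the values of $\mathcal G_u,\mathcal G_y$ at $(U^{(\ell)},y)$, $\mathcal H_x^{(\ell)},\mathcal H_y^{(\ell)}$ those of $\mathcal H_x,\mathcal H_y$ at $(X^{(\ell)},y)$, and $\Psi_a^{(\ell)},\Psi_y^{(\ell)}$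 those of $\Psi_a,\Psi_y$ at $(a^{(\ell)},y)$. Then $\mathcal D_a^{(\ell)}=(\mathcal D_x^{(\ell)},\mathcal D_{\tilde x}^{(\ell)},\mathcal D_u^{(\ell)})$, $\mathcal D_x^{(\ell)}=\gamma'(a^{(\ell)})[\mathcal D_a^{(\ell)}]$, $\mathcal D_a^{(\ell+1)}=\Psi_a^{(\ell)}(\mathcal D_a^{(\ell)})+\Psi_y^{(\ell)}(\delta)$, and explicitly $$\mathcal D_u^{(\ell+1)}=\mathcal G_u^{(\ell)}(\mathcal D_U^{(\ell)})+\mathcal G_y^{(\ell)}(\delta),\quad \mathcal D_U^{(\ell)}=\mathcal D_u^{(\ell)}+\tau K\mathcal D_{\tilde x}^{(\ell)},$$ $$\mathcal D_x^{(\ell+1)}=\mathcal H_x^{(\ell)}(\mathcal D_X^{(\ell)})+\mathcal H_y^{(\ell)}(\delta),\quad \mathcal D_X^{(\ell)}=\mathcal D_x^{(\ell)}-\xi K^*\mathcal D_u^{(\ell+1)},$$ $$\mathcal D_{\tilde x}^{(\ell+1)}=\mathcal D_x^{(\ell+1)}+\zeta\,(\mathcal D_x^{(\ell+1)}-\mathcal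 D_x^{(\ell)}).$$ In addition, the right-hand sides $\mathcal G_u^{(\ell)}(\mathcal D_U^{(\ell)})+\mathcal G_y^{(\ell)}(\delta)$, $\mathcal H_x^{(\ell)}(\mathcal D_X^{(\ell)})+\mathcal H_y^{(\ell)}(\delta)$ and $\Psi_a^{(\ell)}(\mathcal D_a^{(\ell)})+\Psi_y^{(\ell)}(\delta)$ are the (two-sided) directional derivatives, in the ordinary sense, of $(u,y)\mapsto\mathrm{Prox}_{\tau G^*}(u,y,\theta)$ at $(U^{(\ell)},y)$ along $(\mathcal D_U^{(\ell)},\delta)$, of $(x,y)\mapsto\mathrm{Prox}_{\xi H}(x,y,\theta)$ at $(X^{(\ell)},y)$ along $(\mathcal D_X^{(\ell)},\delta)$, and of $(a,y)\mapsto\psi(a,y,\theta)$ at $(a^{(\ell)},y)$ along $(\mathcal D_a^{(\ell)},\delta)$. -/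

import Mathlib

open MeasureTheory

noncomputable section

/-! Weak derivatives -/

/-- `Df` is a weak Jacobian of `f : E → F` on the whole space `E`: both are locally integrable, and
integration by parts holds in every direction against all compactly supported `C¹` functions. -/
def HasWeakJacobian {E F : Type*} [NormedAddCommGroup E] [NormedSpace ℝ E] [MeasureSpace E]
    [NormedAddCommGroup F] [NormedSpace ℝ F] (f : E → F) (Df : E → E →L[ℝ] F) : Prop :=
  LocallyIntegrable f (volume : Measure E) ∧ LocallyIntegrable Df (volume : Measure E) ∧
    ∀ φ : E → ℝ, ContDiff ℝ 1 φ → HasCompactSupport φ → ∀ v : E,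
      ∫ a, φ a • Df a v = -∫ a, fderiv ℝ φ a v • f a

/-- `f` is weakly differentiable. -/
def WeaklyDifferentiable {E F : Type*} [NormedAddCommGroup E] [NormedSpace ℝ E] [MeasureSpace E]
    [NormedAddCommGroup F] [NormedSpace ℝ F] (f : E → F) : Prop :=
  ∃ Df : E → E →L[ℝ] F, HasWeakJacobian f Df

/-- `J u y` is a version of the Jacobian of the map `F` with respect to its first argument `u`:
for every `y` it is a weak Jacobian of `F (·, y)`, and it takes the classical value at every point
at which `F (·, y)` is differentiable. -/
def IsJacobianFst {E Y F : Type*} [NormedAddCommGroup E] [NormedSpace ℝ E] [MeasureSpace E]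
    [NormedAddCommGroup F] [NormedSpace ℝ F] (f : E → Y → F) (J : E → Y → E →L[ℝ] F) : Prop :=
  ∀ y : Y, HasWeakJacobian (fun u => f u y) (fun u => J u y) ∧
    ∀ u : E, DifferentiableAt ℝ (fun u' => f u' y) u → J u y = fderiv ℝ (fun u' => f u' y) u

/-- The same with respect to the second argument `y`. -/
def IsJacobianSnd {E Y F : Type*} [NormedAddCommGroup Y] [NormedSpace ℝ Y] [MeasureSpace Y]
    [NormedAddCommGroup F] [NormedSpace ℝ F] (f : E → Y → F) (J : E → Y → Y →L[ℝ] F) : Prop :=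
  ∀ u : E, HasWeakJacobian (fun y => f u y) (fun y => J u y) ∧
    ∀ y : Y, DifferentiableAt ℝ (fun y' => f u y') y → J u y = fderiv ℝ (fun y' => f u y') y

/-! Convex analysis -/

/-- Proper, closed (lower semicontinuous) and convex (convex epigraph) extended-real function. -/
structure ProperClosedConvex {X : Type*} [NormedAddCommGroup X] [NormedSpace ℝ X]
    (h : X → EReal) : Prop where
  ne_bot : ∀ x, h x ≠ ⊥
  exists_ne_top : ∃ x, h x ≠ ⊤
  closed : LowerSemicontinuous h
  convex : Convex ℝ {p : X × ℝ | h p.1 ≤ (p.2 : EReal)}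

/-- `p` minimizes `z ↦ ‖z - x‖² / 2 + h z`. -/
def IsProx {X : Type*} [NormedAddCommGroup X] (h : X → EReal) (x p : X) : Prop :=
  ∀ z : X, ((1 / 2 * ‖p - x‖ ^ 2 : ℝ) : EReal) + h p ≤ ((1 / 2 * ‖z - x‖ ^ 2 : ℝ) : EReal) + h z

/-- The proximity operator: the minimizer of `z ↦ ‖z - x‖² / 2 + h z`
(it exists and is unique for proper closed convex `h` on a Hilbert space). -/
def prox {X : Type*} [NormedAddCommGroup X] (h : X → EReal) (x : X) : X :=
  Classical.epsilon (IsProx h x)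

/-- The Legendre-Fenchel conjugate. -/
def conjugate {X : Type*} [NormedAddCommGroup X] [InnerProductSpace ℝ X] (h : X → EReal) :
    X → EReal :=
  fun u => ⨆ z : X, ((inner ℝ z u : ℝ) : EReal) - h z

/-! The primal-dual algorithm -/

/-- The data of the primal-dual algorithm for minimizing `x ↦ H(x, y, θ) + G(K x, y, θ)`:
the functions, the linear operator, the step sizes `τ`, `ξ` and the relaxation parameter `ζ`. -/
structure CPData (X U Y Θ : Type*) [NormedAddCommGroup X] [InnerProductSpace ℝ X]
    [NormedAddCommGroup U] [InnerProductSpace ℝ U] where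
  H : X → Y → Θ → EReal
  G : U → Y → Θ → EReal
  K : X →ₗ[ℝ] U
  τ : ℝ
  ξ : ℝ
  ζ : ℝ

namespace CPData

variable {X U Y Θ : Type*} [NormedAddCommGroup X] [InnerProductSpace ℝ X]
  [NormedAddCommGroup U] [InnerProductSpace ℝ U]

/-- `(x, y, θ) ↦ Prox_{ξ H}(x, y, θ)`. -/
def proxH (D : CPData X U Y Θ) (x : X) (y : Y) (θ : Θ) : X :=
  prox (fun z => (D.ξ : EReal) * D.H z y θ) x

/-- `(u, y, θ) ↦ Prox_{τ G*}(u, y, θ)`. -/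
def proxGstar (D : CPData X U Y Θ) (u : U) (y : Y) (θ : Θ) : U :=
  prox (fun w => (D.τ : EReal) * conjugate (fun z => D.G z y θ) w) u

variable [FiniteDimensional ℝ X] [FiniteDimensional ℝ U]

/-- One iteration, acting on the state `a = (x, x̃, u)`. -/
def ψ (D : CPData X U Y Θ) (a : X × X × U) (y : Y) (θ : Θ) : X × X × U :=
  let u' := D.proxGstar (a.2.2 + D.τ • D.K a.2.1) y θ
  let x' := D.proxH (a.1 - D.ξ • LinearMap.adjoint D.K u') y θ
  (x', x' + D.ζ • (x' - a.1), u')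

/-- The map extracting the current estimate `x` from the state `a = (x, x̃, u)`. -/
def γ (a : X × X × U) : X := a.1

/-- The states `a ℓ`, started at `a₀ y θ`. -/
def a (D : CPData X U Y Θ) (a₀ : Y → Θ → X × X × U) : ℕ → Y → Θ → X × X × U
  | 0, y, θ => a₀ y θ
  | ℓ + 1, y, θ => D.ψ (D.a a₀ ℓ y θ) y θ

/-- The iterate `x ℓ`. -/
def x (D : CPData X U Y Θ) (a₀ : Y → Θ → X × X × U) (ℓ : ℕ) (y : Y) (θ : Θ) : X :=
  γ (D.a a₀ ℓ y θ)

/-- The iterate `x̃ ℓ`. -/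
def xt (D : CPData X U Y Θ) (a₀ : Y → Θ → X × X × U) (ℓ : ℕ) (y : Y) (θ : Θ) : X :=
  (D.a a₀ ℓ y θ).2.1

/-- The dual iterate `u ℓ`. -/
def u (D : CPData X U Y Θ) (a₀ : Y → Θ → X × X × U) (ℓ : ℕ) (y : Y) (θ : Θ) : U :=
  (D.a a₀ ℓ y θ).2.2

/-- `U ℓ = u ℓ + τ K (x̃ ℓ)`. -/
def argU (D : CPData X U Y Θ) (a₀ : Y → Θ → X × X × U) (ℓ : ℕ) (y : Y) (θ : Θ) : U :=
  D.u a₀ ℓ y θ + D.τ • D.K (D.xt a₀ ℓ y θ)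

/-- `X ℓ = x ℓ - ξ K* (u (ℓ + 1))`. -/
def argX (D : CPData X U Y Θ) (a₀ : Y → Θ → X × X × U) (ℓ : ℕ) (y : Y) (θ : Θ) : X :=
  D.x a₀ ℓ y θ - D.ξ • LinearMap.adjoint D.K (D.u a₀ (ℓ + 1) y θ)

end CPData

end

/-!
Proximity operators are nonexpansive, and since `ψ` is Lipschitz in `y` uniformly in the state,
shearing the arguments shows that both proximity operators, `ψ` and all iterates are jointly
Lipschitz. By Rademacher's theorem a weak Jacobian of a Lipschitz map is almost everywhere its
classical derivative.

The chain rule along the iterates is not automatic: the graph `{(U ℓ y, y)}` is a null set, so the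
proximity operator need not be differentiable at any of its points. Composing a Lipschitz map `f`
with a differentiable curve nevertheless gives `f` a line derivative along the tangent of the graph
at almost every `y`, equal to the derivative of `y ↦ f (w y) y`. Where both partial derivatives of
`f` exist, approximation by difference quotients with modulus uniform on a measurable piece of the
graph forces the chain rule at the points where that piece has full tangent cone, hence almost
everywhere. Where a partial derivative is missing, the value of its version is free and can be
chosen to make the chain rule true. Only countably many iterates are involved, and two of them have
equal derivatives at almost every point where they agree, so the choice is consistent.
-/

open Filter Topology

theorem exists_forall_le_of_lowerSemicontinuous {α β : Type*} [TopologicalSpace α] [LinearOrder β]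
    {f : α → β} (hf : LowerSemicontinuous f) (x₀ : α) (h : ∀ᶠ x in cocompact α, f x₀ ≤ f x) :
    ∃ x, ∀ z, f x ≤ f z := by
  obtain ⟨K, hK, hKc⟩ := mem_cocompact.1 h
  obtain ⟨x, -, hx⟩ := (hf.lowerSemicontinuousOn (insert x₀ K)).exists_isMinOn
    (Set.insert_nonempty _ _) (hK.insert x₀)
  refine ⟨x, fun z => ?_⟩
  by_cases hz : z ∈ insert x₀ K
  · exact hx hz
  · exact (hx (Set.mem_insert _ _)).trans (hKc fun hzK => hz (Set.mem_insert_of_mem _ hzK))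

section ProperClosedConvex

variable {E : Type*} [NormedAddCommGroup E] [NormedSpace ℝ E] {h : E → EReal}

theorem ProperClosedConvex.exists_eq_coe_of_ne_top (hh : ProperClosedConvex h) {x : E}
    (hx : h x ≠ ⊤) : ∃ r : ℝ, h x = r :=
  ⟨(h x).toReal, (EReal.coe_toReal hx (hh.ne_bot x)).symm⟩

theorem ProperClosedConvex.exists_eq_coe (hh : ProperClosedConvex h) : ∃ x, ∃ r : ℝ, h x = r :=
  let ⟨x, hx⟩ := hh.exists_ne_top
  ⟨x, hh.exists_eq_coe_of_ne_top hx⟩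

theorem ProperClosedConvex.const_mul (hh : ProperClosedConvex h) {c : ℝ} (hc : 0 < c) :
    ProperClosedConvex fun x => (c : EReal) * h x where
  ne_bot x := by
    rw [EReal.mul_ne_bot]
    simp [hh.ne_bot x, hc.le]
  exists_ne_top := by
    obtain ⟨x, r, hr⟩ := hh.exists_eq_coe
    exact ⟨x, by simp only [hr, ← EReal.coe_mul, ne_eq, EReal.coe_ne_top, not_false_eq_true]⟩
  closed :=
    Continuous.comp_lowerSemicontinuous
      (continuous_iff_continuousAt.2 fun _ => EReal.Tendsto.const_mul tendsto_id
        (Or.inl (EReal.coe_ne_bot c)) (Or.inl (EReal.coe_ne_top c)))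
      hh.closed fun _ _ hab => mul_le_mul_of_nonneg_left hab (EReal.coe_nonneg.2 hc.le)
  convex := by
    have hpre : {p : E × ℝ | (c : EReal) * h p.1 ≤ p.2} =
        (LinearMap.id.prodMap (c⁻¹ • LinearMap.id) : E × ℝ →ₗ[ℝ] E × ℝ) ⁻¹'
          {p : E × ℝ | h p.1 ≤ p.2} := by
      ext p
      have hdiv := EReal.le_div_iff_mul_le (a := h p.1) (c := p.2) (EReal.coe_pos.2 hc)
        (EReal.coe_ne_top c)
      simpa [EReal.div_eq_inv_mul, EReal.coe_inv, mul_comm] using hdiv.symm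
    rw [hpre]
    exact hh.convex.linear_preimage _

theorem ProperClosedConvex.apply_add_smul_sub_le (hh : ProperClosedConvex h) {x z : E} {a b : ℝ}
    (hx : h x ≤ a) (hz : h z ≤ b) {t : ℝ} (h0 : 0 ≤ t) (h1 : t ≤ 1) :
    h (x + t • (z - x)) ≤ ((a + t * (b - a) : ℝ) : EReal) :=
  hh.convex.add_smul_sub_mem (x := (x, a)) (y := (z, b)) hx hz ⟨h0, h1⟩

theorem ProperClosedConvex.exists_sub_div_le (hh : ProperClosedConvex h) {x : E} {a : ℝ}
    (hx : h x = a) :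
    ∃ r : ℝ, 0 < r ∧ ∀ z, r ≤ ‖z - x‖ → ((a - ‖z - x‖ / r : ℝ) : EReal) ≤ h z := by
  have hlt : ((a - 1 : ℝ) : EReal) < h x := hx ▸ EReal.coe_lt_coe_iff.2 (sub_one_lt a)
  obtain ⟨r, hr, hball⟩ := Metric.nhds_basis_closedBall.eventually_iff.1 (hh.closed x _ hlt)
  refine ⟨r, hr, fun z hz => ?_⟩
  by_contra! hzlt
  obtain ⟨b, hb⟩ := hh.exists_eq_coe_of_ne_top hzlt.ne_top
  rw [hb, EReal.coe_lt_coe_iff] at hzlt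
  have hzpos : 0 < ‖z - x‖ := hr.trans_le hz
  have htpos : 0 < r / ‖z - x‖ := div_pos hr hzpos
  -- Pull `z` back along the segment to the sphere of radius `r`, where `a - 1 < h`.
  have hmem : x + (r / ‖z - x‖) • (z - x) ∈ Metric.closedBall x r := by
    rw [mem_closedBall_iff_norm, add_sub_cancel_left, norm_smul, Real.norm_of_nonneg htpos.le,
      div_mul_cancel₀ _ hzpos.ne']
  have hseg : a - 1 < a + r / ‖z - x‖ * (b - a) := EReal.coe_lt_coe_iff.1 <|
    (hball hmem).trans_le (hh.apply_add_smul_sub_le hx.le hb.le htpos.le ((div_le_one hzpos).2 hz))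
  have hslope : r / ‖z - x‖ * (b - a) < r / ‖z - x‖ * -(‖z - x‖ / r) :=
    mul_lt_mul_of_pos_left (by linarith) htpos
  have hone : r / ‖z - x‖ * -(‖z - x‖ / r) = -1 := by field_simp
  linarith

end ProperClosedConvex

section Prox

variable {E : Type*} [NormedAddCommGroup E] [InnerProductSpace ℝ E] {h : E → EReal}

theorem ProperClosedConvex.exists_isProx [FiniteDimensional ℝ E] (hh : ProperClosedConvex h)
    (x : E) : ∃ p, IsProx h x p := by
  obtain ⟨z₀, s, hs⟩ := hh.exists_eq_coe
  obtain ⟨r, hr, hlow⟩ := hh.exists_sub_div_le hs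
  refine exists_forall_le_of_lowerSemicontinuous
    (LowerSemicontinuous.add' (continuous_coe_real_ereal.comp (by fun_prop)).lowerSemicontinuous
      hh.closed fun z =>
        EReal.continuousAt_add (Or.inl (EReal.coe_ne_top _)) (Or.inl (EReal.coe_ne_bot _))) z₀ ?_
  filter_upwards [(tendsto_dist_right_cocompact_atTop z₀).eventually_ge_atTop r,
    (tendsto_dist_right_cocompact_atTop z₀).eventually_ge_atTop (2 * ‖z₀ - x‖ + 2 / r)]
    with z hz hz'
  rw [dist_eq_norm] at hz hz'
  refine le_trans ?_ (add_le_add le_rfl (hlow z hz))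
  rw [hs, ← EReal.coe_add, ← EReal.coe_add, EReal.coe_le_coe_iff]
  have htri : ‖z - z₀‖ - ‖z₀ - x‖ ≤ ‖z - x‖ := by
    simpa using norm_sub_le_norm_add (z - z₀) (z₀ - x)
  have h2r : 0 < 2 / r := by positivity
  have hsq : (‖z - z₀‖ - ‖z₀ - x‖) ^ 2 ≤ ‖z - x‖ ^ 2 :=
    pow_le_pow_left₀ (by linarith [norm_nonneg (z₀ - x)]) htri 2
  have hmul : 0 ≤ ‖z - z₀‖ * (‖z - z₀‖ - 2 * ‖z₀ - x‖ - 2 / r) :=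
    mul_nonneg (norm_nonneg _) (by linarith)
  have hdiv : ‖z - z₀‖ / r = ‖z - z₀‖ * (2 / r) / 2 := by ring
  rw [hdiv]
  nlinarith

theorem ProperClosedConvex.isProx_prox [FiniteDimensional ℝ E] (hh : ProperClosedConvex h)
    (x : E) : IsProx h x (prox h x) :=
  Classical.epsilon_spec (hh.exists_isProx x)

theorem IsProx.exists_eq_coe (hh : ProperClosedConvex h) {x p : E} (hp : IsProx h x p) :
    ∃ s : ℝ, h p = s := by
  obtain ⟨z₀, s, hs⟩ := hh.exists_eq_coe
  refine hh.exists_eq_coe_of_ne_top fun htop => ?_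
  have hle := hp z₀
  rw [htop, hs, EReal.coe_add_top, ← EReal.coe_add, top_le_iff] at hle
  exact EReal.coe_ne_top _ hle

theorem IsProx.coe_add_inner_le (hh : ProperClosedConvex h) {x p : E} (hp : IsProx h x p) {s : ℝ}
    (hs : h p = s) (z : E) : ((s + inner ℝ (x - p) (z - p) : ℝ) : EReal) ≤ h z := by
  by_cases hz : h z = ⊤
  · exact hz ▸ le_top
  obtain ⟨b, hb⟩ := hh.exists_eq_coe_of_ne_top hz
  rw [hb, EReal.coe_le_coe_iff]
  have hle : ∀ t ∈ Set.Ioo (0 : ℝ) 1,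
      s + inner ℝ (x - p) (z - p) ≤ b + t * (1 / 2 * ‖z - p‖ ^ 2) := by
    intro t ht
    have hmin := (hp (p + t • (z - p))).trans
      (add_le_add le_rfl (hh.apply_add_smul_sub_le hs.le hb.le ht.1.le ht.2.le))
    rw [hs, ← EReal.coe_add, ← EReal.coe_add, EReal.coe_le_coe_iff] at hmin
    have hexpand : ‖p + t • (z - p) - x‖ ^ 2 =
        ‖p - x‖ ^ 2 - 2 * t * inner ℝ (x - p) (z - p) + t ^ 2 * ‖z - p‖ ^ 2 := by
      rw [add_sub_right_comm, norm_add_sq_real, norm_smul, inner_smul_right, ← neg_sub x p,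
        inner_neg_left, Real.norm_of_nonneg ht.1.le]
      ring
    rw [hexpand] at hmin
    exact le_of_mul_le_mul_left (by nlinarith) ht.1
  have hlim : Tendsto (fun t : ℝ => b + t * (1 / 2 * ‖z - p‖ ^ 2)) (𝓝[>] 0) (𝓝 b) := by
    have hcont : Continuous fun t : ℝ => b + t * (1 / 2 * ‖z - p‖ ^ 2) := by fun_prop
    simpa using (hcont.tendsto 0).mono_left nhdsWithin_le_nhds
  exact ge_of_tendsto hlim (eventually_of_mem (Ioo_mem_nhdsGT one_pos) hle)

theorem IsProx.norm_sub_sq_le_inner (hh : ProperClosedConvex h) {x y p q : E} (hp : IsProx h x p)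
    (hq : IsProx h y q) : ‖p - q‖ ^ 2 ≤ inner ℝ (x - y) (p - q) := by
  obtain ⟨s, hs⟩ := hp.exists_eq_coe hh
  obtain ⟨t, ht⟩ := hq.exists_eq_coe hh
  have hpq := hp.coe_add_inner_le hh hs q
  have hqp := hq.coe_add_inner_le hh ht p
  rw [ht, EReal.coe_le_coe_iff, ← neg_sub p q, inner_neg_right] at hpq
  rw [hs, EReal.coe_le_coe_iff] at hqp
  have hsplit : inner ℝ (x - y) (p - q) =
      inner ℝ (x - p) (p - q) - inner ℝ (y - q) (p - q) + ‖p - q‖ ^ 2 := by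
    rw [← real_inner_self_eq_norm_sq, ← inner_sub_left, ← inner_add_left]
    congr 1
    abel
  linarith

theorem IsProx.dist_le (hh : ProperClosedConvex h) {x y p q : E} (hp : IsProx h x p)
    (hq : IsProx h y q) : dist p q ≤ dist x y := by
  rw [dist_eq_norm, dist_eq_norm]
  have hle := (hp.norm_sub_sq_le_inner hh hq).trans (real_inner_le_norm (x - y) (p - q))
  by_contra! hlt
  nlinarith [norm_nonneg (x - y)]

theorem ProperClosedConvex.lipschitzWith_prox [FiniteDimensional ℝ E]
    (hh : ProperClosedConvex h) : LipschitzWith 1 (prox h) :=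
  LipschitzWith.of_dist_le_mul fun x y => by
    simpa using (hh.isProx_prox x).dist_le hh (hh.isProx_prox y)

theorem lowerSemicontinuous_conjugate (h : E → EReal) : LowerSemicontinuous (conjugate h) :=
  lowerSemicontinuous_iSup fun z => by
    induction h z with
    | bot => simpa using lowerSemicontinuous_const
    | top => simpa using lowerSemicontinuous_const
    | coe b =>
      have hcont : Continuous fun u : E => ((inner ℝ z u - b : ℝ) : EReal) :=
        continuous_coe_real_ereal.comp (by fun_prop)
      exact hcont.lowerSemicontinuous

theorem convex_epigraph_conjugate (h : E → EReal) :
    Convex ℝ {p : E × ℝ | conjugate h p.1 ≤ (p.2 : EReal)} := by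
  simp only [conjugate, iSup_le_iff, Set.ofPred_forall]
  refine convex_iInter fun z => ?_
  induction h z with
  | bot => simpa using convex_empty
  | top => simpa using convex_univ
  | coe b =>
    have hlin : IsLinearMap ℝ fun p : E × ℝ => inner ℝ z p.1 - p.2 :=
      ((innerSL ℝ z).toLinearMap ∘ₗ LinearMap.fst ℝ E ℝ - LinearMap.snd ℝ E ℝ).isLinear
    simpa only [← EReal.coe_sub, EReal.coe_le_coe_iff, sub_le_comm] using
      convex_halfSpace_le hlin b

theorem ProperClosedConvex.conjugate [FiniteDimensional ℝ E] (hh : ProperClosedConvex h) :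
    ProperClosedConvex (conjugate h) where
  ne_bot u := by
    obtain ⟨z, s, hs⟩ := hh.exists_eq_coe
    have hle := le_iSup (fun z : E => ((inner ℝ z u : ℝ) : EReal) - h z) z
    rw [hs, ← EReal.coe_sub] at hle
    exact ((EReal.bot_lt_coe _).trans_le hle).ne'
  exists_ne_top := by
    -- `-p` is a subgradient of `h` at the proximal point `p` of `0`.
    obtain ⟨p, hp⟩ := hh.exists_isProx 0
    obtain ⟨s, hs⟩ := hp.exists_eq_coe hh
    refine ⟨-p, ((iSup_le fun z => ?_).trans_lt (EReal.coe_lt_top (inner ℝ p (-p) - s))).ne⟩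
    have hsub := hp.coe_add_inner_le hh hs z
    rw [zero_sub, inner_sub_right, real_inner_comm, real_inner_comm p] at hsub
    by_cases hz : h z = ⊤
    · simp [hz]
    obtain ⟨b, hb⟩ := hh.exists_eq_coe_of_ne_top hz
    rw [hb, EReal.coe_le_coe_iff] at hsub
    rw [hb, ← EReal.coe_sub, EReal.coe_le_coe_iff]
    linarith
  closed := lowerSemicontinuous_conjugate h
  convex := convex_epigraph_conjugate h

end Prox

section WeakJacobian

variable {E F G : Type*} [NormedAddCommGroup E] [NormedSpace ℝ E] [MeasureSpace E] [BorelSpace E]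
  [NormedAddCommGroup F] [NormedSpace ℝ F] [NormedAddCommGroup G] [NormedSpace ℝ G]

theorem locallyIntegrable_clm_comp {α : Type*} [TopologicalSpace α] [MeasurableSpace α]
    {μ : Measure α} (L : F →L[ℝ] G) {f : α → F} (hf : LocallyIntegrable f μ) :
    LocallyIntegrable (fun x => L (f x)) μ := fun x =>
  let ⟨s, hs, hint⟩ := hf x
  ⟨s, hs, L.integrable_comp hint⟩

namespace HasWeakJacobian

variable {f g : E → F} {Df Df' Dg : E → E →L[ℝ] F}

theorem integrable_smul_apply (hf : HasWeakJacobian f Df) {φ : E → ℝ} (hφ : Continuous φ)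
    (hφc : HasCompactSupport φ) (v : E) : Integrable fun x => φ x • Df x v :=
  (locallyIntegrable_clm_comp (ContinuousLinearMap.apply ℝ F v)
    hf.2.1).integrable_smul_left_of_hasCompactSupport hφ hφc

theorem integrable_fderiv_smul (hf : HasWeakJacobian f Df) {φ : E → ℝ} (hφ : ContDiff ℝ 1 φ)
    (hφc : HasCompactSupport φ) (v : E) : Integrable fun x => fderiv ℝ φ x v • f x :=
  hf.1.integrable_smul_left_of_hasCompactSupport
    ((hφ.continuous_fderiv one_ne_zero).clm_apply continuous_const) (hφc.fderiv_apply ℝ v)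

theorem ae_eq [FiniteDimensional ℝ E] [CompleteSpace F] (hDf : HasWeakJacobian f Df)
    (hDf' : HasWeakJacobian f Df') : Df =ᵐ[volume] Df' := by
  refine ae_eq_of_integral_contDiff_smul_eq hDf.2.1 hDf'.2.1 fun φ hφ hφc => ?_
  ext v
  rw [ContinuousLinearMap.integral_apply
      (hDf.2.1.integrable_smul_left_of_hasCompactSupport hφ.continuous hφc),
    ContinuousLinearMap.integral_apply
      (hDf'.2.1.integrable_smul_left_of_hasCompactSupport hφ.continuous hφc)]
  exact (hDf.2.2 φ (hφ.of_le (by simp)) hφc v).trans (hDf'.2.2 φ (hφ.of_le (by simp)) hφc v).symm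

theorem clm_comp [CompleteSpace F] [CompleteSpace G] (L : F →L[ℝ] G) (hf : HasWeakJacobian f Df) :
    HasWeakJacobian (fun x => L (f x)) (fun x => L ∘L Df x) := by
  refine ⟨locallyIntegrable_clm_comp L hf.1,
    locallyIntegrable_clm_comp (ContinuousLinearMap.compL ℝ E F G L) hf.2.1,
    fun φ hφ hφc v => ?_⟩
  simp only [ContinuousLinearMap.comp_apply, ← L.map_smul]
  rw [L.integral_comp_comm (hf.integrable_smul_apply hφ.continuous hφc v),
    L.integral_comp_comm (hf.integrable_fderiv_smul hφ hφc v), hf.2.2 φ hφ hφc v, map_neg]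

theorem add (hf : HasWeakJacobian f Df) (hg : HasWeakJacobian g Dg) :
    HasWeakJacobian (fun x => f x + g x) (fun x => Df x + Dg x) := by
  refine ⟨hf.1.add hg.1, LocallyIntegrable.add (ε'' := E →L[ℝ] F) hf.2.1 hg.2.1,
    fun φ hφ hφc v => ?_⟩
  simp only [add_apply, smul_add]
  rw [integral_add (hf.integrable_smul_apply hφ.continuous hφc v)
      (hg.integrable_smul_apply hφ.continuous hφc v),
    integral_add (hf.integrable_fderiv_smul hφ hφc v) (hg.integrable_fderiv_smul hφ hφc v),
    hf.2.2 φ hφ hφc v, hg.2.2 φ hφ hφc v, neg_add]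

theorem sub [CompleteSpace F] (hf : HasWeakJacobian f Df) (hg : HasWeakJacobian g Dg) :
    HasWeakJacobian (fun x => f x - g x) (fun x => Df x - Dg x) := by
  simpa [sub_eq_add_neg] using hf.add (hg.clm_comp (-ContinuousLinearMap.id ℝ F))

theorem prodMk [CompleteSpace F] [CompleteSpace G] {g : E → G} {Dg : E → E →L[ℝ] G}
    (hf : HasWeakJacobian f Df) (hg : HasWeakJacobian g Dg) :
    HasWeakJacobian (fun x => (f x, g x)) (fun x => (Df x).prod (Dg x)) := by
  have hsum := (hf.clm_comp (ContinuousLinearMap.inl ℝ F G)).add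
    (hg.clm_comp (ContinuousLinearMap.inr ℝ F G))
  convert hsum using 2 with x x
  · simp
  · ext v <;> simp

end HasWeakJacobian

end WeakJacobian

section Lipschitz

variable {E F : Type*} [NormedAddCommGroup E] [NormedSpace ℝ E] [FiniteDimensional ℝ E]
  [NormedAddCommGroup F] [NormedSpace ℝ F] [FiniteDimensional ℝ F] {C : NNReal} {f : E → F}

theorem locallyIntegrable_fderiv_of_lipschitzWith [MeasurableSpace E] [BorelSpace E]
    {μ : Measure E} [IsLocallyFiniteMeasure μ] (hf : LipschitzWith C f) :
    LocallyIntegrable (fderiv ℝ f) μ := by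
  have : CompleteSpace F := FiniteDimensional.complete ℝ F
  borelize (E →L[ℝ] F)
  exact (memLp_top_of_bound (measurable_fderiv ℝ f).aestronglyMeasurable C
    (.of_forall fun x => norm_fderiv_le_of_lipschitz ℝ hf)).locallyIntegrable le_top

theorem integral_smul_fderiv_eq_neg_of_lipschitzWith [MeasurableSpace E] [BorelSpace E]
    {μ : Measure E} [μ.IsAddHaarMeasure] (hf : LipschitzWith C f) {φ : E → ℝ}
    (hφ : ContDiff ℝ 1 φ) (hφc : HasCompactSupport φ) (v : E) :
    ∫ x, φ x • fderiv ℝ f x v ∂μ = -∫ x, fderiv ℝ φ x v • f x ∂μ := by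
  have : CompleteSpace F := FiniteDimensional.complete ℝ F
  have hint : Integrable (fun x => φ x • fderiv ℝ f x v) μ :=
    (locallyIntegrable_clm_comp (ContinuousLinearMap.apply ℝ F v)
      (locallyIntegrable_fderiv_of_lipschitzWith hf)).integrable_smul_left_of_hasCompactSupport
      hφ.continuous hφc
  have hint' : Integrable (fun x => fderiv ℝ φ x v • f x) μ :=
    hf.continuous.locallyIntegrable.integrable_smul_left_of_hasCompactSupport
      ((hφ.continuous_fderiv one_ne_zero).clm_apply continuous_const) (hφc.fderiv_apply ℝ v)
  obtain ⟨D, hD⟩ := ContDiff.lipschitzWith_of_hasCompactSupport hφc hφ one_ne_zero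
  refine SeparatingDual.eq_iff_forall_dual_eq (R := ℝ) |>.2 fun l => ?_
  rw [map_neg, ← l.integral_comp_comm hint, ← l.integral_comp_comm hint', ← integral_neg]
  calc ∫ x, l (φ x • fderiv ℝ f x v) ∂μ
      = ∫ x, lineDeriv ℝ (l ∘ f) x v * φ x ∂μ := by
        refine integral_congr_ae ?_
        filter_upwards [hf.ae_differentiableAt (μ := μ)] with x hx
        rw [((l.hasFDerivAt.comp x hx.hasFDerivAt).hasLineDerivAt v).lineDeriv]
        simp [mul_comm]
    _ = ∫ x, lineDeriv ℝ φ x (-v) * (l ∘ f) x ∂μ :=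
        (l.lipschitz.comp hf).integral_lineDeriv_mul_eq hD hφc v
    _ = ∫ x, -l (fderiv ℝ φ x v • f x) ∂μ := by
        refine integral_congr_ae (.of_forall fun x => ?_)
        simp [((hφ.differentiable one_ne_zero x).hasFDerivAt.hasLineDerivAt (-v)).lineDeriv]

variable [MeasureSpace E] [BorelSpace E] [(volume : Measure E).IsAddHaarMeasure]

theorem hasWeakJacobian_of_lipschitzWith (hf : LipschitzWith C f) {Df : E → E →L[ℝ] F}
    (hDf : Df =ᵐ[volume] fderiv ℝ f) : HasWeakJacobian f Df := by
  refine ⟨hf.continuous.locallyIntegrable,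
    (locallyIntegrable_fderiv_of_lipschitzWith hf).congr hDf.symm, fun φ hφ hφc v => ?_⟩
  rw [← integral_smul_fderiv_eq_neg_of_lipschitzWith hf hφ hφc v]
  exact integral_congr_ae (hDf.mono fun x hx => by simp only [hx])

theorem HasWeakJacobian.ae_eq_fderiv {Df : E → E →L[ℝ] F} (hDf : HasWeakJacobian f Df)
    (hf : LipschitzWith C f) : Df =ᵐ[volume] fderiv ℝ f :=
  have : CompleteSpace F := FiniteDimensional.complete ℝ F
  hDf.ae_eq (hasWeakJacobian_of_lipschitzWith hf (ae_eq_refl _))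

theorem weaklyDifferentiable_of_lipschitzWith (hf : LipschitzWith C f) : WeaklyDifferentiable f :=
  ⟨_, hasWeakJacobian_of_lipschitzWith hf (ae_eq_refl _)⟩

end Lipschitz

section TangentCone

variable {E F : Type*} [NormedAddCommGroup E] [NormedSpace ℝ E] [NormedAddCommGroup F]
  [NormedSpace ℝ F]

theorem ae_tangentConeAt_eq_univ [FiniteDimensional ℝ E] [MeasurableSpace E] [BorelSpace E]
    (μ : Measure E) [μ.IsAddHaarMeasure] (s : Set E) :
    ∀ᵐ x ∂μ, x ∈ s → tangentConeAt ℝ s x = Set.univ := by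
  refine ae_imp_of_ae_restrict ?_
  filter_upwards [Besicovitch.ae_tendsto_measure_inter_div μ s] with x hx
  refine Set.eq_univ_of_forall fun v => ?_
  have hexists : ∀ n : ℕ, ∃ (r : ℝ) (w : E), 0 < r ∧ r < 1 / ((n : ℝ) + 1) ∧
      dist w v ≤ 1 / ((n : ℝ) + 1) ∧ x + r • w ∈ s := by
    intro n
    have hn : 0 < 1 / ((n : ℝ) + 1) := Nat.one_div_pos_of_nat
    have hmeets := Measure.eventually_nonempty_inter_smul_of_density_one μ s x hx
      (Metric.closedBall v (1 / ((n : ℝ) + 1))) measurableSet_closedBall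
      (Metric.measure_closedBall_pos μ v hn).ne'
    obtain ⟨r, ⟨z, hzs, hz⟩, hr⟩ := (hmeets.and (Ioo_mem_nhdsGT hn)).exists
    obtain ⟨_, rfl, _, ⟨w, hw, rfl⟩, rfl⟩ := Set.mem_add.1 hz
    exact ⟨r, w, hr.1, hr.2, hw, hzs⟩
  choose r w hrpos hrlt hw hs using hexists
  have hrlim : Tendsto r atTop (𝓝 0) := squeeze_zero (fun n => (hrpos n).le)
    (fun n => (hrlt n).le) tendsto_one_div_add_atTop_nhds_zero_nat
  have hwlim : Tendsto w atTop (𝓝 v) := tendsto_iff_dist_tendsto_zero.2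
    (squeeze_zero (fun _ => dist_nonneg) hw tendsto_one_div_add_atTop_nhds_zero_nat)
  refine mem_tangentConeAt_of_seq atTop (fun n => (r n)⁻¹) (fun n => r n • w n) ?_
    (.of_forall hs) ?_
  · simpa using hrlim.smul hwlim
  · simpa [smul_smul, inv_mul_cancel₀ (hrpos _).ne'] using hwlim

theorem norm_apply_le_of_mem_tangentConeAt {f : E → F} {f' : E →L[ℝ] F} {s : Set E} {x v : E}
    {C : ℝ} (hf : HasFDerivWithinAt f f' s x) (hC : ∀ᶠ z in 𝓝[s] x, ‖f z - f x‖ ≤ C * ‖z - x‖)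
    (hv : v ∈ tangentConeAt ℝ s x) : ‖f' v‖ ≤ C * ‖v‖ := by
  obtain ⟨α, l, hl, c, d, hd, hds, hcd⟩ := exists_fun_of_mem_tangentConeAt hv
  have hlim : Tendsto (fun n => x + d n) l (𝓝[s] x) :=
    tendsto_nhdsWithin_iff.2 ⟨by simpa using tendsto_const_nhds.add hd, hds⟩
  refine le_of_tendsto_of_tendsto (hf.lim hd hds hcd).norm (hcd.norm.const_mul C) ?_
  filter_upwards [hlim.eventually hC] with n hn
  rw [add_sub_cancel_left] at hn
  calc ‖c n • (f (x + d n) - f x)‖ = ‖c n‖ * ‖f (x + d n) - f x‖ := norm_smul _ _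
    _ ≤ ‖c n‖ * (C * ‖d n‖) := by gcongr
    _ = C * ‖c n • d n‖ := by rw [norm_smul]; ring

theorem norm_le_of_tangentConeAt_eq_univ {f : E → F} {f' : E →L[ℝ] F} {s : Set E} {x : E} {C : ℝ}
    (hf : HasFDerivWithinAt f f' s x) (hs : tangentConeAt ℝ s x = Set.univ) (hC0 : 0 ≤ C)
    (hC : ∀ᶠ z in 𝓝[s] x, ‖f z - f x‖ ≤ C * ‖z - x‖) : ‖f'‖ ≤ C :=
  f'.opNorm_le_bound hC0 fun v => norm_apply_le_of_mem_tangentConeAt hf hC (hs ▸ Set.mem_univ v)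

theorem ae_fderiv_eq_of_eq [FiniteDimensional ℝ E] [MeasurableSpace E] [BorelSpace E]
    (μ : Measure E) [μ.IsAddHaarMeasure] (f g : E → F) :
    ∀ᵐ x ∂μ, f x = g x → DifferentiableAt ℝ f x → DifferentiableAt ℝ g x →
      fderiv ℝ f x = fderiv ℝ g x := by
  filter_upwards [ae_tangentConeAt_eq_univ μ {x | f x = g x}] with x hx heq hf hg
  have huniq : UniqueDiffWithinAt ℝ {x | f x = g x} x := ⟨by simp [hx heq], subset_closure heq⟩
  exact huniq.eq hf.hasFDerivAt.hasFDerivWithinAt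
    (hg.hasFDerivAt.hasFDerivWithinAt.congr (fun _ hz => hz) heq)

end TangentCone

section Diagonal

variable {Y F : Type*} [NormedAddCommGroup Y] [NormedSpace ℝ Y] [NormedAddCommGroup F]
  [NormedSpace ℝ F]

/-- The points `w` at which `Φ w` is approximated by the affine map with linear part `Q`, up to the
relative error `ε`, on the whole ball of radius `r`. Countably many of these sets cover the points
where `Φ w` is differentiable at `w`. -/
def linearApproxSet (Φ : Y → Y → F) (Q : Y →L[ℝ] F) (ε r : ℝ) : Set Y :=
  {w | ∀ z ∈ Metric.ball w r, ‖Φ w z - Φ w w - Q (z - w)‖ ≤ ε * ‖z - w‖}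

variable {Φ : Y → Y → F} {Q q r : Y →L[ℝ] F} {y : Y}

theorem exists_mem_linearApproxSet (hq : HasFDerivAt (Φ y) q y) {ε : ℝ} (hQ : ‖q - Q‖ < ε) :
    ∃ n : ℕ, y ∈ linearApproxSet Φ Q ε (1 / (n + 1)) := by
  obtain ⟨ρ, hρ, hball⟩ := Metric.eventually_nhds_iff_ball.1 (hq.isLittleO.def (sub_pos.2 hQ))
  obtain ⟨n, hn⟩ := exists_nat_one_div_lt hρ
  refine ⟨n, fun z hz => ?_⟩
  calc ‖Φ y z - Φ y y - Q (z - y)‖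
      = ‖(Φ y z - Φ y y - q (z - y)) + (q - Q) (z - y)‖ := by rw [sub_apply]; congr 1; abel
    _ ≤ (ε - ‖q - Q‖) * ‖z - y‖ + ‖q - Q‖ * ‖z - y‖ :=
        norm_add_le_of_le (hball z (Metric.ball_subset_ball hn.le hz)) ((q - Q).le_opNorm _)
    _ = ε * ‖z - y‖ := by ring

theorem norm_sub_le_of_mem_linearApproxSet {ε ρ : ℝ} (hε : 0 ≤ ε) (hρ : 0 < ρ)
    (hcone : tangentConeAt ℝ (linearApproxSet Φ Q ε ρ) y = Set.univ)
    (hr : HasFDerivAt (fun z => Φ z z - Φ z y) r y) : ‖r - Q‖ ≤ ε := by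
  refine norm_le_of_tangentConeAt_eq_univ (hr.sub Q.hasFDerivAt).hasFDerivWithinAt hcone hε ?_
  filter_upwards [nhdsWithin_le_nhds (Metric.ball_mem_nhds y hρ), eventually_mem_nhdsWithin]
    with z hz hzS
  calc ‖Φ z z - Φ z y - Q z - (Φ y y - Φ y y - Q y)‖
      = ‖Φ z y - Φ z z - Q (y - z)‖ := by rw [← norm_neg, map_sub]; congr 1; abel
    _ ≤ ε * ‖y - z‖ := hzS y (Metric.mem_ball_comm.1 hz)
    _ = ε * ‖z - y‖ := by rw [norm_sub_rev]

theorem ae_eq_of_hasFDerivAt_diagonal [FiniteDimensional ℝ Y] [MeasurableSpace Y] [BorelSpace Y]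
    [SecondCountableTopology F] (μ : Measure Y) [μ.IsAddHaarMeasure] (Φ : Y → Y → F) :
    ∀ᵐ y ∂μ, ∀ q r : Y →L[ℝ] F, HasFDerivAt (Φ y) q y →
      HasFDerivAt (fun z => Φ z z - Φ z y) r y → r = q := by
  let Q := TopologicalSpace.denseSeq (Y →L[ℝ] F)
  have hcone : ∀ᵐ y ∂μ, ∀ m j n : ℕ,
      y ∈ linearApproxSet Φ (Q j) (1 / (m + 1)) (1 / (n + 1)) →
        tangentConeAt ℝ (linearApproxSet Φ (Q j) (1 / (m + 1)) (1 / (n + 1))) y = Set.univ := by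
    simp only [ae_all_iff]
    exact fun m j n => ae_tangentConeAt_eq_univ μ _
  filter_upwards [hcone] with y hy q r hq hr
  have hsmall : ∀ m : ℕ, ‖r - q‖ ≤ 1 / ((m : ℝ) + 1) + 1 / ((m : ℝ) + 1) := by
    intro m
    have hm : 0 < 1 / ((m : ℝ) + 1) := Nat.one_div_pos_of_nat
    obtain ⟨j, hj⟩ := (TopologicalSpace.denseRange_denseSeq (Y →L[ℝ] F)).exists_dist_lt q hm
    rw [dist_eq_norm] at hj
    obtain ⟨n, hn⟩ := exists_mem_linearApproxSet hq hj
    rw [← sub_add_sub_cancel r (Q j) q]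
    exact norm_add_le_of_le
      (norm_sub_le_of_mem_linearApproxSet hm.le Nat.one_div_pos_of_nat (hy m j n hn) hr)
      (norm_sub_rev q (Q j) ▸ hj.le)
  have hlim : Tendsto (fun m : ℕ => 1 / ((m : ℝ) + 1) + 1 / ((m : ℝ) + 1)) atTop (𝓝 0) := by
    simpa using tendsto_one_div_add_atTop_nhds_zero_nat.add
      (tendsto_one_div_add_atTop_nhds_zero_nat (𝕜 := ℝ))
  exact sub_eq_zero.1 (norm_le_zero_iff.1 (ge_of_tendsto' hlim hsmall))

end Diagonal

section LineDeriv

variable {V W F : Type*} [NormedAddCommGroup V] [NormedSpace ℝ V] [NormedAddCommGroup W]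
  [NormedSpace ℝ W] [NormedAddCommGroup F] [NormedSpace ℝ F]

theorem hasLineDerivAt_of_comp_of_lipschitzWith {C : NNReal} {f : V → F} (hf : LipschitzWith C f)
    {c : W → V} {y v : W} {a : V} {d : F} (hc : HasLineDerivAt ℝ c a y v)
    (hd : HasLineDerivAt ℝ (f ∘ c) d y v) : HasLineDerivAt ℝ f d (c y) a := by
  let e : ℝ → F := fun t => f (c y + t • a) - f (c (y + t • v))
  have he : HasDerivAt e 0 0 := by
    refine HasDerivAt.of_isLittleO ((Asymptotics.IsBigO.of_bound C (.of_forall fun t => ?_))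
      |>.trans_isLittleO hc.isLittleO)
    have hlip := hf.dist_le_mul (c y + t • a) (c (y + t • v))
    rw [dist_eq_norm, dist_comm, dist_eq_norm] at hlip
    simpa [e, sub_sub] using hlip
  simpa [HasLineDerivAt, e, Function.comp_def] using HasDerivAt.fun_add hd he

end LineDeriv

section Graph

variable {E Y F : Type*} [NormedAddCommGroup E] [NormedSpace ℝ E] [NormedAddCommGroup Y]
  [NormedSpace ℝ Y] [NormedAddCommGroup F] [NormedSpace ℝ F]

theorem ae_hasFDerivAt_graph_eq [FiniteDimensional ℝ Y] [MeasurableSpace Y] [BorelSpace Y]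
    [SecondCountableTopology F] (μ : Measure Y) [μ.IsAddHaarMeasure] (f : E → Y → F)
    (g : Y → E) :
    ∀ᵐ y ∂μ, ∀ (p : E →L[ℝ] F) (q : Y →L[ℝ] F) (A : Y →L[ℝ] E) (d : Y →L[ℝ] F),
      HasFDerivAt (fun u => f u y) p (g y) → HasFDerivAt (fun z => f (g y) z) q y →
      HasFDerivAt g A y → HasFDerivAt (fun z => f (g z) z) d y → d = p ∘L A + q := by
  filter_upwards [ae_eq_of_hasFDerivAt_diagonal μ fun w z => f (g w) z]
    with y hy p q A d hp hq hA hd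
  exact sub_eq_iff_eq_add'.1 (hy q (d - p ∘L A) hq (hd.sub (hp.comp y hA)))

theorem exists_clm_comp_eq_of_ker_le_ker [FiniteDimensional ℝ E] {A : Y →L[ℝ] E} {B : Y →L[ℝ] F}
    (h : ∀ v, A v = 0 → B v = 0) : ∃ P : E →L[ℝ] F, P ∘L A = B := by
  let Q := A.toLinearMap.ker.liftQ B.toLinearMap h
  let e := A.toLinearMap.quotKerEquivRange
  obtain ⟨P, hP⟩ := LinearMap.exists_extend (Q ∘ₗ e.symm.toLinearMap)
  refine ⟨LinearMap.toContinuousLinearMap P, ContinuousLinearMap.ext fun v => ?_⟩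
  have hPv : P (A v) = Q (e.symm ⟨A v, v, rfl⟩) := LinearMap.congr_fun hP ⟨A v, v, rfl⟩
  exact hPv.trans (congrArg Q (A.toLinearMap.quotKerEquivRange_symm_apply_image v _))

/-- The linear maps `p` and `q` are the classical partial derivatives of `f` at `(u, y)`, whenever
those exist; a missing partial derivative may be replaced by anything. -/
def ExtendsPartialFDerivs (f : E → Y → F) (u : E) (y : Y) (p : E →L[ℝ] F) (q : Y →L[ℝ] F) : Prop :=
  (DifferentiableAt ℝ (fun u' => f u' y) u → p = fderiv ℝ (fun u' => f u' y) u) ∧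
    (DifferentiableAt ℝ (f u) y → q = fderiv ℝ (f u) y)

theorem extendsPartialFDerivs_fderiv (f : E → Y → F) (u : E) (y : Y) :
    ExtendsPartialFDerivs f u y (fderiv ℝ (fun u' => f u' y) u) (fderiv ℝ (f u) y) :=
  ⟨fun _ => rfl, fun _ => rfl⟩

theorem exists_extendsPartialFDerivs_of_hasLineDerivAt [FiniteDimensional ℝ E] {f : E → Y → F}
    {u : E} {y : Y} {A : Y →L[ℝ] E} {d : Y →L[ℝ] F}
    (hline : ∀ δ, HasLineDerivAt ℝ (fun p : E × Y => f p.1 p.2) (d δ) (u, y) (A δ, δ))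
    (hchain : DifferentiableAt ℝ (fun u' => f u' y) u → DifferentiableAt ℝ (f u) y →
      d = fderiv ℝ (fun u' => f u' y) u ∘L A + fderiv ℝ (f u) y) :
    ∃ p q, ExtendsPartialFDerivs f u y p q ∧ d = p ∘L A + q := by
  by_cases hsnd : DifferentiableAt ℝ (f u) y
  · by_cases hfst : DifferentiableAt ℝ (fun u' => f u' y) u
    · exact ⟨_, _, extendsPartialFDerivs_fderiv f u y, hchain hfst hsnd⟩
    have hker : ∀ v, A v = 0 → (d - fderiv ℝ (f u) y) v = 0 := by
      intro v hv
      have hd := hline v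
      have hq := hsnd.hasFDerivAt.hasLineDerivAt v
      simp only [HasLineDerivAt, hv, Prod.smul_mk, smul_zero, Prod.mk_add_mk, add_zero] at hd hq
      rw [sub_apply, hd.unique hq, sub_self]
    obtain ⟨P, hP⟩ := exists_clm_comp_eq_of_ker_le_ker hker
    exact ⟨P, _, ⟨fun h => (hfst h).elim, fun _ => rfl⟩, by rw [hP, sub_add_cancel]⟩
  · exact ⟨_, d - fderiv ℝ (fun u' => f u' y) u ∘L A, ⟨fun _ => rfl, fun h => (hsnd h).elim⟩,
      (add_sub_cancel _ _).symm⟩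

variable [FiniteDimensional ℝ E] [FiniteDimensional ℝ Y] [FiniteDimensional ℝ F] {C : NNReal}
  {f : E → Y → F}

theorem ae_exists_partialDerivs_chain_rule [MeasurableSpace Y] [BorelSpace Y]
    {μ : Measure Y} [μ.IsAddHaarMeasure] {ι : Type*} [Countable ι]
    (hf : LipschitzWith C fun p : E × Y => f p.1 p.2) {g : ι → Y → E}
    (hg : ∀ i, ∃ K, LipschitzWith K (g i)) :
    ∀ᵐ y ∂μ, ∀ u, ∃ p q, ExtendsPartialFDerivs f u y p q ∧
      ∀ i, g i y = u → fderiv ℝ (fun z => f (g i z) z) y = p ∘L fderiv ℝ (g i) y + q := by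
  choose K hK using hg
  have hdiff : ∀ᵐ y ∂μ, ∀ i, DifferentiableAt ℝ (g i) y :=
    ae_all_iff.2 fun i => (hK i).ae_differentiableAt
  have hcomp : ∀ᵐ y ∂μ, ∀ i, DifferentiableAt ℝ (fun z => f (g i z) z) y :=
    ae_all_iff.2 fun i => (hf.comp ((hK i).prodMk LipschitzWith.id)).ae_differentiableAt
  filter_upwards [hdiff, hcomp, ae_all_iff.2 fun i => ae_hasFDerivAt_graph_eq μ f (g i),
    ae_all_iff.2 fun i => ae_all_iff.2 fun j => ae_fderiv_eq_of_eq μ (g i) (g j),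
    ae_all_iff.2 fun i => ae_all_iff.2 fun j =>
      ae_fderiv_eq_of_eq μ (fun z => f (g i z) z) (fun z => f (g j z) z)]
    with y hdg hdf hchain hgeq hfeq u
  by_cases hu : ∃ i, g i y = u
  · obtain ⟨i, rfl⟩ := hu
    have hline : ∀ δ, HasLineDerivAt ℝ (fun p : E × Y => f p.1 p.2)
        (fderiv ℝ (fun z => f (g i z) z) y δ) (g i y, y) (fderiv ℝ (g i) y δ, δ) := fun δ =>
      hasLineDerivAt_of_comp_of_lipschitzWith (c := fun z => (g i z, z)) hf
        (((hdg i).hasFDerivAt.prodMk (hasFDerivAt_id y)).hasLineDerivAt δ)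
        ((hdf i).hasFDerivAt.hasLineDerivAt δ)
    obtain ⟨p, q, hext, hpq⟩ := exists_extendsPartialFDerivs_of_hasLineDerivAt hline
      fun hfst hsnd => hchain i _ _ _ _ hfst.hasFDerivAt hsnd.hasFDerivAt (hdg i).hasFDerivAt
        (hdf i).hasFDerivAt
    refine ⟨p, q, hext, fun j hj => ?_⟩
    rw [hfeq j i (by simp only [hj]) (hdf j) (hdf i), hgeq j i hj (hdg j) (hdg i), hpq]
  · exact ⟨_, _, extendsPartialFDerivs_fderiv f u y, fun i hi => (hu ⟨i, hi⟩).elim⟩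

theorem isJacobianFst_of_lipschitzWith [MeasureSpace E] [BorelSpace E]
    [(volume : Measure E).IsAddHaarMeasure] {Y : Type*} {f : E → Y → F}
    (hf : ∀ y, LipschitzWith C fun u => f u y) {J : E → Y → E →L[ℝ] F}
    (hJ : ∀ u y, DifferentiableAt ℝ (fun u' => f u' y) u → J u y = fderiv ℝ (fun u' => f u' y) u) :
    IsJacobianFst f J := fun y =>
  ⟨hasWeakJacobian_of_lipschitzWith (hf y) ((hf y).ae_differentiableAt.mono fun u => hJ u y),
    fun u => hJ u y⟩

theorem isJacobianSnd_of_lipschitzWith [MeasureSpace Y] [BorelSpace Y]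
    [(volume : Measure Y).IsAddHaarMeasure] {E : Type*} {f : E → Y → F}
    (hf : ∀ u, LipschitzWith C (f u)) {J : E → Y → Y →L[ℝ] F}
    (hJ : ∀ u y, DifferentiableAt ℝ (f u) y → J u y = fderiv ℝ (f u) y) :
    IsJacobianSnd f J := fun u =>
  ⟨hasWeakJacobian_of_lipschitzWith (hf u) ((hf u).ae_differentiableAt.mono (hJ u)), hJ u⟩

variable [MeasureSpace E] [BorelSpace E] [(volume : Measure E).IsAddHaarMeasure]
  [MeasureSpace Y] [BorelSpace Y] [(volume : Measure Y).IsAddHaarMeasure]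

theorem exists_isJacobian_of_ae_exists (hf : LipschitzWith C fun p : E × Y => f p.1 p.2)
    {R : E → Y → (E →L[ℝ] F) → (Y →L[ℝ] F) → Prop}
    (h : ∀ᵐ y : Y, ∀ u, ∃ p q, ExtendsPartialFDerivs f u y p q ∧ R u y p q) :
    ∃ Ju Jy, IsJacobianFst f Ju ∧ IsJacobianSnd f Jy ∧
      ∀ᵐ y : Y, ∀ u, R u y (Ju u y) (Jy u y) := by
  have htotal : ∀ u y, ∃ p q, ExtendsPartialFDerivs f u y p q ∧
      ((∃ p q, ExtendsPartialFDerivs f u y p q ∧ R u y p q) → R u y p q) := by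
    intro u y
    by_cases hR : ∃ p q, ExtendsPartialFDerivs f u y p q ∧ R u y p q
    · obtain ⟨p, q, hext, hpq⟩ := hR
      exact ⟨p, q, hext, fun _ => hpq⟩
    · exact ⟨_, _, extendsPartialFDerivs_fderiv f u y, fun h => (hR h).elim⟩
  choose Ju Jy hext hJ using htotal
  have hfst : ∀ y, LipschitzWith C fun u => f u y := fun y => by
    simpa [Function.comp_def] using hf.comp (LipschitzWith.prodMk_right y)
  have hsnd : ∀ u, LipschitzWith C (f u) := fun u => by
    simpa [Function.comp_def] using hf.comp (LipschitzWith.prodMk_left u)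
  exact ⟨Ju, Jy, isJacobianFst_of_lipschitzWith hfst fun u y => (hext u y).1,
    isJacobianSnd_of_lipschitzWith hsnd fun u y => (hext u y).2,
    h.mono fun y hy u => hJ u y (hy u)⟩

theorem exists_isJacobian_chain_rule {ι : Type*} [Countable ι]
    (hf : ∃ C, LipschitzWith C fun p : E × Y => f p.1 p.2) {g : ι → Y → E}
    (hg : ∀ i, ∃ K, LipschitzWith K (g i)) :
    ∃ (Ju : E → Y → E →L[ℝ] F) (Jy : E → Y → Y →L[ℝ] F),
      IsJacobianFst f Ju ∧ IsJacobianSnd f Jy ∧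
      ∀ (Dg : ι → Y → Y →L[ℝ] E) (Df : ι → Y → Y →L[ℝ] F),
        (∀ i, HasWeakJacobian (g i) (Dg i)) →
        (∀ i, HasWeakJacobian (fun z => f (g i z) z) (Df i)) →
        ∀ᵐ y : Y, ∀ i δ,
          Df i y δ = Ju (g i y) y (Dg i y δ) + Jy (g i y) y δ ∧
          HasLineDerivAt ℝ (fun p : E × Y => f p.1 p.2)
            (Ju (g i y) y (Dg i y δ) + Jy (g i y) y δ) (g i y, y) (Dg i y δ, δ) := by
  obtain ⟨C, hf⟩ := hf
  obtain ⟨Ju, Jy, hJu, hJy, hJ⟩ :=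
    exists_isJacobian_of_ae_exists hf (ae_exists_partialDerivs_chain_rule hf hg)
  refine ⟨Ju, Jy, hJu, hJy, fun Dg Df hDg hDf => ?_⟩
  choose K hK using hg
  have hcomp : ∀ i, LipschitzWith _ fun z => f (g i z) z := fun i =>
    hf.comp ((hK i).prodMk LipschitzWith.id)
  filter_upwards [hJ, ae_all_iff.2 fun i => (hK i).ae_differentiableAt,
    ae_all_iff.2 fun i => (hcomp i).ae_differentiableAt,
    ae_all_iff.2 fun i => (hDg i).ae_eq_fderiv (hK i),
    ae_all_iff.2 fun i => (hDf i).ae_eq_fderiv (hcomp i)]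
    with y hchain hdg hdf hDg hDf i δ
  have hDfδ : Df i y δ = Ju (g i y) y (Dg i y δ) + Jy (g i y) y δ := by
    simp [hDf i, hDg i, hchain (g i y) i rfl]
  refine ⟨hDfδ, hDfδ ▸ ?_⟩
  exact hasLineDerivAt_of_comp_of_lipschitzWith (c := fun z => (g i z, z)) hf
    (hDg i ▸ ((hdg i).hasFDerivAt.prodMk (hasFDerivAt_id y)).hasLineDerivAt δ)
    (hDf i ▸ (hdf i).hasFDerivAt.hasLineDerivAt δ)

end Graph

section Shear

variable {E Y F : Type*} [SeminormedAddCommGroup E] [PseudoMetricSpace Y] [PseudoMetricSpace F]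

theorem lipschitzWith_of_lipschitzWith_shear {A B L : NNReal} {f : E → Y → F} {w : Y → E}
    (hf : ∀ y, LipschitzWith A fun x => f x y) (hw : LipschitzWith B w)
    (hshear : ∀ a, LipschitzWith L fun y => f (a - w y) y) (x : E) :
    LipschitzWith (L + A * B) (f x) := by
  refine LipschitzWith.of_dist_le_mul fun y y' => ?_
  have hfst : dist (f (x + w y - w y') y') (f x y') ≤ A * (B * dist y y') := by
    refine ((hf y').dist_le_mul _ _).trans ?_
    rw [dist_eq_norm, add_sub_assoc, add_sub_cancel_left, ← dist_eq_norm]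
    gcongr
    exact hw.dist_le_mul y y'
  calc dist (f x y) (f x y')
      ≤ dist (f x y) (f (x + w y - w y') y') + dist (f (x + w y - w y') y') (f x y') :=
        dist_triangle _ _ _
    _ ≤ L * dist y y' + A * (B * dist y y') :=
        add_le_add (by simpa using (hshear (x + w y)).dist_le_mul y y') hfst
    _ = ↑(L + A * B) * dist y y' := by push_cast; ring

end Shear

namespace CPData

variable {X U Y Θ : Type*} [NormedAddCommGroup X] [InnerProductSpace ℝ X]
  [NormedAddCommGroup U] [InnerProductSpace ℝ U] (D : CPData X U Y Θ) {θ : Θ}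

theorem fderiv_γ (a : X × X × U) : fderiv ℝ γ a = ContinuousLinearMap.fst ℝ X (X × U) :=
  fderiv_fst

theorem lipschitzWith_proxH_fst [FiniteDimensional ℝ X] (hξ : 0 < D.ξ) {y : Y}
    (hH : ProperClosedConvex fun x => D.H x y θ) : LipschitzWith 1 fun x => D.proxH x y θ :=
  (hH.const_mul hξ).lipschitzWith_prox

theorem lipschitzWith_proxGstar_fst [FiniteDimensional ℝ U] (hτ : 0 < D.τ) {y : Y}
    (hG : ProperClosedConvex fun u => D.G u y θ) : LipschitzWith 1 fun u => D.proxGstar u y θ :=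
  (hG.conjugate.const_mul hτ).lipschitzWith_prox

variable [FiniteDimensional ℝ X] [FiniteDimensional ℝ U] {a₀ : Y → Θ → X × X × U}

section Lipschitz

variable [NormedAddCommGroup Y]

theorem lipschitzWith_proxGstar_snd {L : NNReal} (hψ : ∀ a, LipschitzWith L fun y => D.ψ a y θ)
    (u : U) : LipschitzWith L fun y => D.proxGstar u y θ := by
  simpa [ψ, Function.comp_def] using
    (LipschitzWith.prod_snd.comp LipschitzWith.prod_snd).comp (hψ (0, 0, u))

theorem exists_lipschitzWith_proxGstar (hτ : 0 < D.τ)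
    (hG : ∀ y, ProperClosedConvex fun u => D.G u y θ)
    (hψ : ∃ L, ∀ a, LipschitzWith L fun y => D.ψ a y θ) :
    ∃ C, LipschitzWith C fun p : U × Y => D.proxGstar p.1 p.2 θ :=
  let ⟨_, hL⟩ := hψ
  ⟨_, LipschitzWith.uncurry (fun y => D.lipschitzWith_proxGstar_fst hτ (hG y))
    (D.lipschitzWith_proxGstar_snd hL)⟩

theorem exists_lipschitzWith_proxH (hξ : 0 < D.ξ)
    (hH : ∀ y, ProperClosedConvex fun x => D.H x y θ)
    (hψ : ∃ L, ∀ a, LipschitzWith L fun y => D.ψ a y θ) :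
    ∃ C, LipschitzWith C fun p : X × Y => D.proxH p.1 p.2 θ := by
  obtain ⟨L, hL⟩ := hψ
  let Kadj : U →L[ℝ] X := D.ξ • LinearMap.toContinuousLinearMap (LinearMap.adjoint D.K)
  have hw : LipschitzWith _ fun y => Kadj (D.proxGstar 0 y θ) :=
    Kadj.lipschitz.comp (D.lipschitzWith_proxGstar_snd hL 0)
  have hshear : ∀ x, LipschitzWith (1 * L) fun y => D.proxH (x - Kadj (D.proxGstar 0 y θ)) y θ :=
    fun x => by
      simpa [ψ, Kadj, Function.comp_def] using LipschitzWith.prod_fst.comp (hL (x, 0, 0))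
  have hfst := fun y => D.lipschitzWith_proxH_fst hξ (hH y)
  exact ⟨_, LipschitzWith.uncurry hfst (lipschitzWith_of_lipschitzWith_shear hfst hw hshear)⟩

theorem exists_lipschitzWith_ψ
    (hGstar : ∃ C, LipschitzWith C fun p : U × Y => D.proxGstar p.1 p.2 θ)
    (hH : ∃ C, LipschitzWith C fun p : X × Y => D.proxH p.1 p.2 θ) :
    ∃ C, LipschitzWith C fun p : (X × X × U) × Y => D.ψ p.1 p.2 θ := by
  obtain ⟨_, hGstar⟩ := hGstar
  obtain ⟨_, hH⟩ := hH
  obtain ⟨_, hK⟩ : ∃ C, LipschitzWith C fun x => D.τ • D.K x :=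
    ⟨_, (D.τ • LinearMap.toContinuousLinearMap D.K).lipschitz⟩
  obtain ⟨_, hKadj⟩ : ∃ C, LipschitzWith C fun u => D.ξ • LinearMap.adjoint D.K u :=
    ⟨_, (D.ξ • LinearMap.toContinuousLinearMap (LinearMap.adjoint D.K)).lipschitz⟩
  have hy : LipschitzWith _ fun p : (X × X × U) × Y => p.2 := LipschitzWith.prod_snd
  have hx : LipschitzWith _ fun p : (X × X × U) × Y => p.1.1 :=
    LipschitzWith.prod_fst.comp LipschitzWith.prod_fst
  have hxt : LipschitzWith _ fun p : (X × X × U) × Y => p.1.2.1 :=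
    LipschitzWith.prod_fst.comp (LipschitzWith.prod_snd.comp LipschitzWith.prod_fst)
  have hu : LipschitzWith _ fun p : (X × X × U) × Y => p.1.2.2 :=
    LipschitzWith.prod_snd.comp (LipschitzWith.prod_snd.comp LipschitzWith.prod_fst)
  have hu' := hGstar.comp ((hu.add (hK.comp hxt)).prodMk hy)
  have hx' := hH.comp ((hx.sub (hKadj.comp hu')).prodMk hy)
  have hxt' := hx'.add ((lipschitzWith_smul D.ζ).comp (hx'.sub hx))
  have hψ := hx'.prodMk (hxt'.prodMk hu')
  exact ⟨_, hψ⟩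

theorem exists_lipschitzWith_a
    (hψ : ∃ C, LipschitzWith C fun p : (X × X × U) × Y => D.ψ p.1 p.2 θ)
    (ha₀ : ∃ C, LipschitzWith C fun y => a₀ y θ) (ℓ : ℕ) :
    ∃ C, LipschitzWith C fun y => D.a a₀ ℓ y θ := by
  obtain ⟨_, hψ⟩ := hψ
  induction ℓ with
  | zero => exact ha₀
  | succ ℓ ih =>
    obtain ⟨_, ih⟩ := ih
    have hsucc := hψ.comp (ih.prodMk LipschitzWith.id)
    exact ⟨_, hsucc⟩

theorem exists_lipschitzWith_x {ℓ : ℕ} (ha : ∃ C, LipschitzWith C fun y => D.a a₀ ℓ y θ) :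
    ∃ C, LipschitzWith C fun y => D.x a₀ ℓ y θ :=
  ha.imp' _ fun _ h => LipschitzWith.prod_fst.comp h

theorem exists_lipschitzWith_xt {ℓ : ℕ} (ha : ∃ C, LipschitzWith C fun y => D.a a₀ ℓ y θ) :
    ∃ C, LipschitzWith C fun y => D.xt a₀ ℓ y θ :=
  ha.imp' _ fun _ h => (LipschitzWith.prod_fst.comp LipschitzWith.prod_snd).comp h

theorem exists_lipschitzWith_u {ℓ : ℕ} (ha : ∃ C, LipschitzWith C fun y => D.a a₀ ℓ y θ) :
    ∃ C, LipschitzWith C fun y => D.u a₀ ℓ y θ :=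
  ha.imp' _ fun _ h => (LipschitzWith.prod_snd.comp LipschitzWith.prod_snd).comp h

theorem exists_lipschitzWith_argU {ℓ : ℕ} (ha : ∃ C, LipschitzWith C fun y => D.a a₀ ℓ y θ) :
    ∃ C, LipschitzWith C fun y => D.argU a₀ ℓ y θ :=
  let ⟨_, hu⟩ := D.exists_lipschitzWith_u ha
  let ⟨_, hxt⟩ := D.exists_lipschitzWith_xt ha
  ⟨_, hu.add ((D.τ • LinearMap.toContinuousLinearMap D.K).lipschitz.comp hxt)⟩

theorem exists_lipschitzWith_argX {ℓ : ℕ} (ha : ∃ C, LipschitzWith C fun y => D.a a₀ ℓ y θ)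
    (ha' : ∃ C, LipschitzWith C fun y => D.a a₀ (ℓ + 1) y θ) :
    ∃ C, LipschitzWith C fun y => D.argX a₀ ℓ y θ :=
  let ⟨_, hx⟩ := D.exists_lipschitzWith_x ha
  let ⟨_, hu⟩ := D.exists_lipschitzWith_u ha'
  ⟨_, hx.sub ((D.ξ • LinearMap.toContinuousLinearMap (LinearMap.adjoint D.K)).lipschitz.comp hu)⟩

end Lipschitz

section WeakJacobian

variable [NormedAddCommGroup Y] [NormedSpace ℝ Y] [MeasureSpace Y] [BorelSpace Y] {ℓ : ℕ}
  {Du : Y → Y →L[ℝ] U} {Dx Dx' Dxt : Y → Y →L[ℝ] X}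

theorem hasWeakJacobian_a (hx : HasWeakJacobian (fun y => D.x a₀ ℓ y θ) Dx)
    (hxt : HasWeakJacobian (fun y => D.xt a₀ ℓ y θ) Dxt)
    (hu : HasWeakJacobian (fun y => D.u a₀ ℓ y θ) Du) :
    HasWeakJacobian (fun y => D.a a₀ ℓ y θ) fun y => (Dx y).prod ((Dxt y).prod (Du y)) :=
  hx.prodMk (hxt.prodMk hu)

theorem hasWeakJacobian_argU (hu : HasWeakJacobian (fun y => D.u a₀ ℓ y θ) Du)
    (hxt : HasWeakJacobian (fun y => D.xt a₀ ℓ y θ) Dxt) :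
    HasWeakJacobian (fun y => D.argU a₀ ℓ y θ)
      fun y => Du y + (D.τ • LinearMap.toContinuousLinearMap D.K) ∘L Dxt y :=
  hu.add (hxt.clm_comp (D.τ • LinearMap.toContinuousLinearMap D.K))

theorem hasWeakJacobian_argX (hx : HasWeakJacobian (fun y => D.x a₀ ℓ y θ) Dx)
    (hu : HasWeakJacobian (fun y => D.u a₀ (ℓ + 1) y θ) Du) :
    HasWeakJacobian (fun y => D.argX a₀ ℓ y θ) fun y =>
      Dx y - (D.ξ • LinearMap.toContinuousLinearMap (LinearMap.adjoint D.K)) ∘L Du y :=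
  hx.sub (hu.clm_comp (D.ξ • LinearMap.toContinuousLinearMap (LinearMap.adjoint D.K)))

theorem hasWeakJacobian_xt_succ (hx : HasWeakJacobian (fun y => D.x a₀ ℓ y θ) Dx)
    (hx' : HasWeakJacobian (fun y => D.x a₀ (ℓ + 1) y θ) Dx') :
    HasWeakJacobian (fun y => D.xt a₀ (ℓ + 1) y θ)
      fun y => Dx' y + (D.ζ • ContinuousLinearMap.id ℝ X) ∘L (Dx' y - Dx y) :=
  hx'.add ((hx'.sub hx).clm_comp (D.ζ • ContinuousLinearMap.id ℝ X))

end WeakJacobian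

theorem weaklyDifferentiable_iterates [NormedAddCommGroup Y] [NormedSpace ℝ Y]
    [FiniteDimensional ℝ Y] [MeasureSpace Y] [BorelSpace Y] [(volume : Measure Y).IsAddHaarMeasure]
    {ℓ : ℕ} (ha : ∃ C, LipschitzWith C fun y => D.a a₀ ℓ y θ) :
    WeaklyDifferentiable (fun y => D.a a₀ ℓ y θ) ∧ WeaklyDifferentiable (fun y => D.u a₀ ℓ y θ) ∧
      WeaklyDifferentiable (fun y => D.x a₀ ℓ y θ) ∧
      WeaklyDifferentiable (fun y => D.xt a₀ ℓ y θ) :=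
  have ⟨_, hu⟩ := D.exists_lipschitzWith_u ha
  have ⟨_, hx⟩ := D.exists_lipschitzWith_x ha
  have ⟨_, hxt⟩ := D.exists_lipschitzWith_xt ha
  have ⟨_, ha⟩ := ha
  ⟨weaklyDifferentiable_of_lipschitzWith ha, weaklyDifferentiable_of_lipschitzWith hu,
    weaklyDifferentiable_of_lipschitzWith hx, weaklyDifferentiable_of_lipschitzWith hxt⟩

end CPData

theorem mainTheorem10 {X U Y Θ : Type*}
    [NormedAddCommGroup X] [InnerProductSpace ℝ X] [FiniteDimensional ℝ X]
    [MeasurableSpace X] [BorelSpace X]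
    [NormedAddCommGroup U] [InnerProductSpace ℝ U] [FiniteDimensional ℝ U]
    [MeasurableSpace U] [BorelSpace U]
    [NormedAddCommGroup Y] [InnerProductSpace ℝ Y] [FiniteDimensional ℝ Y]
    [MeasurableSpace Y] [BorelSpace Y]
    (D : CPData X U Y Θ) (hτ : 0 < D.τ) (hξ : 0 < D.ξ) (θ : Θ)
    (hH : ∀ y, ProperClosedConvex fun x => D.H x y θ)
    (hG : ∀ y, ProperClosedConvex fun u => D.G u y θ)
    (hψ : ∃ L, ∀ a, LipschitzWith L fun y => D.ψ a y θ)
    (a₀ : Y → Θ → X × X × U) (ha₀ : ∃ C, LipschitzWith C fun y => a₀ y θ) :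
    (∀ ℓ, WeaklyDifferentiable (fun y => D.a a₀ ℓ y θ) ∧
      WeaklyDifferentiable (fun y => D.u a₀ ℓ y θ) ∧
      WeaklyDifferentiable (fun y => D.x a₀ ℓ y θ) ∧
      WeaklyDifferentiable (fun y => D.xt a₀ ℓ y θ)) ∧
    ∃ (Gu : U → Y → U →L[ℝ] U) (Gy : U → Y → Y →L[ℝ] U)
      (Hx : X → Y → X →L[ℝ] X) (Hy : X → Y → Y →L[ℝ] X)
      (Ψa : X × X × U → Y → X × X × U →L[ℝ] X × X × U)
      (Ψy : X × X × U → Y → Y →L[ℝ] X × X × U),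
      IsJacobianFst (fun u y => D.proxGstar u y θ) Gu ∧
      IsJacobianSnd (fun u y => D.proxGstar u y θ) Gy ∧
      IsJacobianFst (fun x y => D.proxH x y θ) Hx ∧
      IsJacobianSnd (fun x y => D.proxH x y θ) Hy ∧
      IsJacobianFst (fun a y => D.ψ a y θ) Ψa ∧
      IsJacobianSnd (fun a y => D.ψ a y θ) Ψy ∧
      ∀ (Da : ℕ → Y → Y →L[ℝ] X × X × U) (Du : ℕ → Y → Y →L[ℝ] U)
        (Dx Dxt : ℕ → Y → Y →L[ℝ] X),
        (∀ ℓ, HasWeakJacobian (fun y => D.a a₀ ℓ y θ) (Da ℓ)) →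
        (∀ ℓ, HasWeakJacobian (fun y => D.u a₀ ℓ y θ) (Du ℓ)) →
        (∀ ℓ, HasWeakJacobian (fun y => D.x a₀ ℓ y θ) (Dx ℓ)) →
        (∀ ℓ, HasWeakJacobian (fun y => D.xt a₀ ℓ y θ) (Dxt ℓ)) →
        ∀ᵐ y : Y, ∀ (ℓ : ℕ) (δ : Y),
          let DU : U := Du ℓ y δ + D.τ • D.K (Dxt ℓ y δ)
          let DX : X := Dx ℓ y δ - D.ξ • LinearMap.adjoint D.K (Du (ℓ + 1) y δ)
          -- the general recursion for the state and its read-out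
          Da ℓ y δ = (Dx ℓ y δ, Dxt ℓ y δ, Du ℓ y δ) ∧
          Dx ℓ y δ = fderiv ℝ CPData.γ (D.a a₀ ℓ y θ) (Da ℓ y δ) ∧
          Da (ℓ + 1) y δ = Ψa (D.a a₀ ℓ y θ) y (Da ℓ y δ) + Ψy (D.a a₀ ℓ y θ) y δ ∧
          -- the explicit recursion
          Du (ℓ + 1) y δ = Gu (D.argU a₀ ℓ y θ) y DU + Gy (D.argU a₀ ℓ y θ) y δ ∧
          Dx (ℓ + 1) y δ = Hx (D.argX a₀ ℓ y θ) y DX + Hy (D.argX a₀ ℓ y θ) y δ ∧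
          Dxt (ℓ + 1) y δ = Dx (ℓ + 1) y δ + D.ζ • (Dx (ℓ + 1) y δ - Dx ℓ y δ) ∧
          -- the Jacobians act as derivatives along the directions to which they are applied
          HasLineDerivAt ℝ (fun p : U × Y => D.proxGstar p.1 p.2 θ)
            (Gu (D.argU a₀ ℓ y θ) y DU + Gy (D.argU a₀ ℓ y θ) y δ)
            (D.argU a₀ ℓ y θ, y) (DU, δ) ∧
          HasLineDerivAt ℝ (fun p : X × Y => D.proxH p.1 p.2 θ)
            (Hx (D.argX a₀ ℓ y θ) y DX + Hy (D.argX a₀ ℓ y θ) y δ)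
            (D.argX a₀ ℓ y θ, y) (DX, δ) ∧
          HasLineDerivAt ℝ (fun p : (X × X × U) × Y => D.ψ p.1 p.2 θ)
            (Ψa (D.a a₀ ℓ y θ) y (Da ℓ y δ) + Ψy (D.a a₀ ℓ y θ) y δ)
            (D.a a₀ ℓ y θ, y) (Da ℓ y δ, δ) := by
  have hProxG := D.exists_lipschitzWith_proxGstar hτ hG hψ
  have hProxH := D.exists_lipschitzWith_proxH hξ hH hψ
  have hStep := D.exists_lipschitzWith_ψ hProxG hProxH
  have ha := D.exists_lipschitzWith_a hStep ha₀
  have : (volume : Measure (X × U)).IsAddHaarMeasure := Measure.prod.instIsAddHaarMeasure _ _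
  have : (volume : Measure (X × X × U)).IsAddHaarMeasure := Measure.prod.instIsAddHaarMeasure _ _
  obtain ⟨Gu, Gy, hGu, hGy, hGchain⟩ := exists_isJacobian_chain_rule
    (f := fun u y => D.proxGstar u y θ) hProxG fun ℓ => D.exists_lipschitzWith_argU (ha ℓ)
  obtain ⟨Hx, Hy, hHx, hHy, hHchain⟩ := exists_isJacobian_chain_rule
    (f := fun x y => D.proxH x y θ) hProxH fun ℓ => D.exists_lipschitzWith_argX (ha ℓ) (ha (ℓ + 1))
  obtain ⟨Ψa, Ψy, hΨa, hΨy, hΨchain⟩ := exists_isJacobian_chain_rule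
    (f := fun a y => D.ψ a y θ) hStep ha
  refine ⟨fun ℓ => D.weaklyDifferentiable_iterates (ha ℓ), Gu, Gy, Hx, Hy, Ψa, Ψy,
    hGu, hGy, hHx, hHy, hΨa, hΨy, fun Da Du Dx Dxt hDa hDu hDx hDxt => ?_⟩
  filter_upwards [
    hGchain _ _ (fun ℓ => D.hasWeakJacobian_argU (hDu ℓ) (hDxt ℓ)) fun ℓ => hDu (ℓ + 1),
    hHchain _ _ (fun ℓ => D.hasWeakJacobian_argX (hDx ℓ) (hDu (ℓ + 1))) fun ℓ => hDx (ℓ + 1),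
    hΨchain _ _ hDa fun ℓ => hDa (ℓ + 1),
    ae_all_iff.2 fun ℓ => (hDa ℓ).ae_eq (D.hasWeakJacobian_a (hDx ℓ) (hDxt ℓ) (hDu ℓ)),
    ae_all_iff.2 fun ℓ => (hDxt (ℓ + 1)).ae_eq (D.hasWeakJacobian_xt_succ (hDx ℓ) (hDx (ℓ + 1)))]
    with y hG hH hΨ hsplit hrelax ℓ δ
  have hDaδ : Da ℓ y δ = (Dx ℓ y δ, Dxt ℓ y δ, Du ℓ y δ) := DFunLike.congr_fun (hsplit ℓ) δ
  have hDxδ : Dx ℓ y δ = fderiv ℝ CPData.γ (D.a a₀ ℓ y θ) (Da ℓ y δ) := by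
    rw [hDaδ, CPData.fderiv_γ, ContinuousLinearMap.coe_fst']
  exact ⟨hDaδ, hDxδ, (hΨ ℓ δ).1, (hG ℓ δ).1, (hH ℓ δ).1, DFunLike.congr_fun (hrelax ℓ) δ,
    (hG ℓ δ).2, (hH ℓ δ).2, (hΨ ℓ δ).2⟩
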